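/- An alphabet is a finite set of letters; $A^*$ denotes the finite strings over $A$, $A^+$ the nonempty ones, $\lambda$ the empty string. A morphism is a map $h:B^*\to A^*$ with $h(xy)=h(x)h(y)$; it is a coding if $|h(b)|=1$ for every letter $b$. A morphism $h:B^*\to B^*$ is prolongable on a letter $c$ if $h(c)=cx$ for some string $x$ such that $h^m(x)\neq\lambda$ for all $m\ge 0$; then $h^\omega(c)$ denotes the infinite word $c\,x\,h(x)\,h^2(x)\cdots$. An infinite word $\alpha$ over an alphabet $A$ is a morphic word with growth $\Theta(n^k)$ if there are an alphabet $B$, a morphism $h:B^*\to B^*$, a coding $\tau:B^*\to A^*$ and a letter $c\in B$ such that $h$ is prolongable on $c$, $\alpha=\tau(h^\omega(c))$, and $|h^n(c)|$ is in $\Theta(n^k)$. Let $L$ be the set of zigzag lists over $A$, defined recursively as the nonempty finite lists $l=[(f_1,x_1),\dots,(f_m,x_m)]$ in which, for each $i$, either $f_i\in\{F,B\}$ and $x_i\in L$, or $f_i=S$ and $x_i\in A^+$. For $n\ge 1$ put $$R(l,n)=f_1(x_1,n)\,f_2(x_2,n)\cdots f_m(x_m,n),$$ $$F(l,n)=R(l,1)R(l,2)\cdots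 R(l,n),\qquad B(l,n)=R(l,n)\cdots R(l,2)R(l,1),\qquad S(r,n)=r.$$ The depth of $l$ is the maximum of the depths of its terms, where a term $(S,r)$ has depth $1$, and terms $(F,x)$ and $(B,x)$ have depth $\operatorname{depth}(x)+1$. An infinite word $\alpha$ over $A$ is a zigzag word of depth $k$ if $\alpha=q\,R(l,1)R(l,2)R(l,3)\cdots$ for some $q\in A^*$ and some $l\in L$ of depth $k$. Theorem. Let $k\ge 0$ be an integer. Every morphic word with growth $\Theta(n^k)$ is a zigzag word of depth $k$. -/

import Mathlib

open Filter Asymptotics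

universe u v

/-! Finite words (strings) over `A` are elements of the free monoid `FreeMonoid A`: the product is
concatenation, `1` is the empty string and `FreeMonoid.of a` is the one-letter string `a`.
Infinite words over `A` are functions `ℕ → A` (letters are indexed from `0`). -/

/-- The string `x` is a prefix of the infinite word `α`. -/
def IsPrefixOf {A : Type u} (x : FreeMonoid A) (α : ℕ → A) : Prop :=
  x.toList = (List.range x.length).map α

/-- The string `q w(0) w(1) ⋯ w(n-1)`. -/
def partialConcat {A : Type u} (q : FreeMonoid A) (w : ℕ → FreeMonoid A) (n : ℕ) : FreeMonoid A :=
  q * ((List.range n).map w).prod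

/-- `α` is the infinite word `q w(0) w(1) w(2) ⋯`: all the finite partial concatenations are
prefixes of `α`, and they are arbitrarily long (so that they determine `α`). -/
def IsInfiniteConcat {A : Type u} (q : FreeMonoid A) (w : ℕ → FreeMonoid A) (α : ℕ → A) : Prop :=
  (∀ n, IsPrefixOf (partialConcat q w n) α) ∧ ∀ N, ∃ n, N ≤ (partialConcat q w n).length

/-- The string `x` is mortal for the morphism `h`: `h^m(x)` is empty for some `m ≥ 0`. -/
def IsMortal {B : Type v} (h : FreeMonoid B →* FreeMonoid B) (x : FreeMonoid B) : Prop :=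
  ∃ m : ℕ, h^[m] x = 1

/-- The morphism `τ` is a coding: it maps every letter to a string of length one. -/
def IsCoding {B : Type v} {A : Type u} (τ : FreeMonoid B →* FreeMonoid A) : Prop :=
  ∀ b : B, (τ (FreeMonoid.of b)).length = 1

/-- `h` is prolongable on the letter `c`, and `β` is the pure morphic word
`h^ω(c) = c x h(x) h²(x) ⋯`, where `h(c) = c x` with `x` not mortal. -/
def IsPureMorphicLimit {B : Type v} (h : FreeMonoid B →* FreeMonoid B) (c : B) (β : ℕ → B) :
    Prop :=
  ∃ x : FreeMonoid B, h (FreeMonoid.of c) = FreeMonoid.of c * x ∧ ¬ IsMortal h x ∧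
    IsInfiniteConcat (FreeMonoid.of c) (fun i => h^[i] x) β

/-- `α` is the image `τ(β)` of the infinite word `β` under the morphism `τ`. -/
def IsImageOf {B : Type v} {A : Type u} (τ : FreeMonoid B →* FreeMonoid A) (β : ℕ → B)
    (α : ℕ → A) : Prop :=
  IsInfiniteConcat 1 (fun i => τ (FreeMonoid.of (β i))) α

/-- `α` is a morphic word with growth `Θ(n^k)`: there are a finite alphabet `B`, a morphism `h`
on it, a coding `τ` and a letter `c` such that `h` is prolongable on `c`, `α = τ(h^ω(c))`, and
`|h^n(c)|` is in `Θ(n^k)`. -/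
def IsMorphicWithGrowth {A : Type u} (α : ℕ → A) (k : ℕ) : Prop :=
  ∃ (B : Type v) (_ : Finite B) (h : FreeMonoid B →* FreeMonoid B)
    (τ : FreeMonoid B →* FreeMonoid A) (c : B) (β : ℕ → B),
    IsCoding τ ∧ IsPureMorphicLimit h c β ∧ IsImageOf τ β α ∧
    (fun n : ℕ => ((h^[n] (FreeMonoid.of c)).length : ℝ)) =Θ[atTop] (fun n : ℕ => (n : ℝ) ^ k)

mutual

/-- A term of a zigzag list: `(F, l)` or `(B, l)` with `l` a zigzag list, or `(S, r)` with `r` a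
nonempty string. -/
inductive ZigzagTerm (A : Type u) : Type u
  | F : ZigzagList A → ZigzagTerm A
  | B : ZigzagList A → ZigzagTerm A
  | S : (r : FreeMonoid A) → r ≠ 1 → ZigzagTerm A

/-- A zigzag list: a nonempty finite list of zigzag terms. -/
inductive ZigzagList (A : Type u) : Type u
  | single : ZigzagTerm A → ZigzagList A
  | cons : ZigzagTerm A → ZigzagList A → ZigzagList A

end

mutual

/-- `F(l,n) = R(l,1) R(l,2) ⋯ R(l,n)`, `B(l,n) = R(l,n) ⋯ R(l,2) R(l,1)` and `S(r,n) = r`.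
Only the values at `n ≥ 1` matter. -/
def ZigzagTerm.eval {A : Type u} : ZigzagTerm A → ℕ → FreeMonoid A
  | .F l, n => ((List.range n).map fun i => l.R (i + 1)).prod
  | .B l, n => ((List.range n).reverse.map fun i => l.R (i + 1)).prod
  | .S r _, _ => r

/-- `R([(f_1,x_1), …, (f_m,x_m)], n) = f_1(x_1,n) ⋯ f_m(x_m,n)`. -/
def ZigzagList.R {A : Type u} : ZigzagList A → ℕ → FreeMonoid A
  | .single t, n => t.eval n
  | .cons t l, n => t.eval n * l.R n

end

mutual

/-- The depth of a term: `1` for `(S, r)`, and `depth l + 1` for `(F, l)` and `(B, l)`. -/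
def ZigzagTerm.depth {A : Type u} : ZigzagTerm A → ℕ
  | .F l => l.depth + 1
  | .B l => l.depth + 1
  | .S _ _ => 1

/-- The depth of a list: the maximum of the depths of its terms. -/
def ZigzagList.depth {A : Type u} : ZigzagList A → ℕ
  | .single t => t.depth
  | .cons t l => max t.depth l.depth

end

/-- `α` is a zigzag word of depth `k`: `α = q R(l,1) R(l,2) R(l,3) ⋯` for some string `q` and some
zigzag list `l` of depth `k`. -/
def IsZigzagOfDepth {A : Type u} (α : ℕ → A) (k : ℕ) : Prop :=
  ∃ (q : FreeMonoid A) (l : ZigzagList A), l.depth = k ∧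
    IsInfiniteConcat q (fun i => l.R (i + 1)) α

/-! ### Products of words indexed by an initial segment of `ℕ` -/

theorem prod_reverse_range_succ {M : Type*} [Monoid M] (f : ℕ → M) (n : ℕ) :
    ((List.range (n + 1)).reverse.map f).prod = f n * ((List.range n).reverse.map f).prod := by
  simp [List.range_succ]

theorem length_prod_range {A : Type u} (f : ℕ → FreeMonoid A) (n : ℕ) :
    ((List.range n).map f).prod.length = ∑ i ∈ Finset.range n, (f i).length := by
  induction n with
  | zero => simp
  | succ n ih =>
    rw [List.prod_range_succ, FreeMonoid.length_mul, ih, Finset.sum_range_succ]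

theorem length_prod_reverse_range {A : Type u} (f : ℕ → FreeMonoid A) (n : ℕ) :
    ((List.range n).reverse.map f).prod.length = ∑ i ∈ Finset.range n, (f i).length := by
  induction n with
  | zero => simp
  | succ n ih =>
    rw [prod_reverse_range_succ, FreeMonoid.length_mul, ih, Finset.sum_range_succ, add_comm]

theorem partialConcat_zero {A : Type u} (q : FreeMonoid A) (w : ℕ → FreeMonoid A) :
    partialConcat q w 0 = q := by
  simp [partialConcat]

theorem partialConcat_succ {A : Type u} (q : FreeMonoid A) (w : ℕ → FreeMonoid A) (n : ℕ) :
    partialConcat q w (n + 1) = partialConcat q w n * w n := by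
  rw [partialConcat, partialConcat, List.prod_range_succ, mul_assoc]

/-! ### Sequences of words given by finite, possibly empty, lists of zigzag terms -/

/-- The concatenation of the values at `n` of the terms of a possibly empty list. -/
def evalTerms {A : Type u} (ts : List (ZigzagTerm A)) (n : ℕ) : FreeMonoid A :=
  (ts.map fun t => t.eval n).prod

theorem evalTerms_nil {A : Type u} (n : ℕ) : evalTerms ([] : List (ZigzagTerm A)) n = 1 := rfl

theorem evalTerms_append {A : Type u} (s t : List (ZigzagTerm A)) (n : ℕ) :
    evalTerms (s ++ t) n = evalTerms s n * evalTerms t n := by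
  simp [evalTerms]

theorem evalTerms_singleton {A : Type u} (t : ZigzagTerm A) (n : ℕ) :
    evalTerms [t] n = t.eval n := by
  simp [evalTerms]

theorem exists_zigzagList_of_ne_nil {A : Type u} (ts : List (ZigzagTerm A)) (h : ts ≠ []) :
    ∃ l : ZigzagList A, ∀ n, l.R n = evalTerms ts n := by
  induction ts with
  | nil => exact absurd rfl h
  | cons t ts ih =>
    rcases eq_or_ne ts [] with rfl | hts
    · exact ⟨.single t, fun n => by rw [ZigzagList.R, evalTerms_singleton]⟩
    · obtain ⟨l, hl⟩ := ih hts
      exact ⟨.cons t l, fun n => by rw [ZigzagList.R, hl]; simp [evalTerms]⟩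

theorem exists_evalTerms_const {A : Type u} (r : FreeMonoid A) :
    ∃ ts : List (ZigzagTerm A), ∀ n, evalTerms ts n = r := by
  by_cases h : r = 1
  · exact ⟨[], fun n => by rw [evalTerms_nil, h]⟩
  · exact ⟨[.S r h], fun n => by rw [evalTerms_singleton, ZigzagTerm.eval]⟩

theorem exists_evalTerms_forward {A : Type u} (ts : List (ZigzagTerm A)) :
    ∃ ts' : List (ZigzagTerm A), ∀ n,
      evalTerms ts' n = ((List.range n).map fun i => evalTerms ts (i + 1)).prod := by
  rcases eq_or_ne ts [] with rfl | hts
  · exact ⟨[], fun n => by simp [evalTerms_nil]⟩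
  · obtain ⟨l, hl⟩ := exists_zigzagList_of_ne_nil ts hts
    exact ⟨[.F l], fun n => by simp only [evalTerms_singleton, ZigzagTerm.eval, hl]⟩

theorem exists_evalTerms_backward {A : Type u} (ts : List (ZigzagTerm A)) :
    ∃ ts' : List (ZigzagTerm A), ∀ n,
      evalTerms ts' n = ((List.range n).reverse.map fun i => evalTerms ts (i + 1)).prod := by
  rcases eq_or_ne ts [] with rfl | hts
  · exact ⟨[], fun n => by simp [evalTerms_nil]⟩
  · obtain ⟨l, hl⟩ := exists_zigzagList_of_ne_nil ts hts
    exact ⟨[.B l], fun n => by simp only [evalTerms_singleton, ZigzagTerm.eval, hl]⟩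

/-- All sufficiently late shifts of the sequence `w` are given by lists of zigzag terms. -/
def EventuallyZigzag {A : Type u} (w : ℕ → FreeMonoid A) : Prop :=
  ∃ M₀, ∀ M, M₀ ≤ M → ∃ ts : List (ZigzagTerm A), ∀ n, evalTerms ts n = w (n + M)

namespace EventuallyZigzag

variable {A : Type u} {w w₁ w₂ : ℕ → FreeMonoid A}

theorem const (r : FreeMonoid A) : EventuallyZigzag fun _ => r :=
  ⟨0, fun _ _ => exists_evalTerms_const r⟩

theorem mul (h₁ : EventuallyZigzag w₁) (h₂ : EventuallyZigzag w₂) :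
    EventuallyZigzag fun n => w₁ n * w₂ n := by
  obtain ⟨M₁, h₁⟩ := h₁
  obtain ⟨M₂, h₂⟩ := h₂
  refine ⟨max M₁ M₂, fun M hM => ?_⟩
  obtain ⟨s, hs⟩ := h₁ M (le_of_max_le_left hM)
  obtain ⟨t, ht⟩ := h₂ M (le_of_max_le_right hM)
  exact ⟨s ++ t, fun n => by rw [evalTerms_append, hs, ht]⟩

theorem of_succ (h : EventuallyZigzag fun n => w (n + 1)) : EventuallyZigzag w := by
  obtain ⟨M₀, h⟩ := h
  refine ⟨M₀ + 1, fun M hM => ?_⟩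
  obtain ⟨M, rfl⟩ : ∃ M', M = M' + 1 := ⟨M - 1, by omega⟩
  obtain ⟨ts, hts⟩ := h M (by omega)
  exact ⟨ts, fun n => hts n⟩

theorem of_recurrence (h₁ : EventuallyZigzag w₁) (h₂ : EventuallyZigzag w₂)
    (hw : ∀ n, w (n + 1) = w₁ n * w n * w₂ n) : EventuallyZigzag w := by
  obtain ⟨M₁, h₁⟩ := h₁
  obtain ⟨M₂, h₂⟩ := h₂
  refine ⟨max M₁ M₂ + 1, fun M hM => ?_⟩
  obtain ⟨M, rfl⟩ : ∃ M', M = M' + 1 := ⟨M - 1, by omega⟩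
  obtain ⟨s, hs⟩ := h₁ M (by omega)
  obtain ⟨t, ht⟩ := h₂ M (by omega)
  obtain ⟨s', hs'⟩ := exists_evalTerms_backward s
  obtain ⟨t', ht'⟩ := exists_evalTerms_forward t
  obtain ⟨c, hc⟩ := exists_evalTerms_const (w (M + 1))
  refine ⟨s' ++ c ++ t', fun n => ?_⟩
  rw [evalTerms_append, evalTerms_append, hs', hc, ht']
  induction n with
  | zero => simp
  | succ n ih =>
    have e : n + 1 + (M + 1) = (n + (M + 1)) + 1 := by omega
    have e' : n + 1 + M = n + (M + 1) := by omega
    rw [prod_reverse_range_succ, List.prod_range_succ (fun i => evalTerms t (i + 1)), e,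
      hw (n + (M + 1)), ← ih, hs, ht, e']
    simp only [mul_assoc]

end EventuallyZigzag

/-! ### Lengths of zigzag words -/

/-- `f n` and `n ^ d` differ by at most a constant factor, for `n ≥ 1`. -/
def ComparableToPow (f : ℕ → ℕ) (d : ℕ) : Prop :=
  ∃ C : ℕ, ∀ n, 1 ≤ n → n ^ d ≤ C * f n ∧ f n ≤ C * n ^ d

theorem succ_pow_succ_le (n d : ℕ) :
    (n + 1) ^ (d + 1) ≤ n ^ (d + 1) + (d + 1) * (n + 1) ^ d := by
  induction d with
  | zero => simp
  | succ d ih =>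
    have h : n ^ (d + 1) ≤ (n + 1) ^ (d + 1) := Nat.pow_le_pow_left (Nat.le_succ n) _
    calc (n + 1) ^ (d + 1 + 1) = (n + 1) * (n + 1) ^ (d + 1) := by ring
      _ ≤ (n + 1) * (n ^ (d + 1) + (d + 1) * (n + 1) ^ d) := Nat.mul_le_mul_left _ ih
      _ = n ^ (d + 1 + 1) + (d + 1) * (n + 1) ^ (d + 1) + n ^ (d + 1) := by ring
      _ ≤ n ^ (d + 1 + 1) + (d + 1) * (n + 1) ^ (d + 1) + (n + 1) ^ (d + 1) := by gcongr
      _ = _ := by ring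

theorem pow_succ_le_mul_sum (n d : ℕ) :
    n ^ (d + 1) ≤ (d + 1) * ∑ i ∈ Finset.range n, (i + 1) ^ d := by
  induction n with
  | zero => simp
  | succ n ih =>
    rw [Finset.sum_range_succ, mul_add]
    exact (succ_pow_succ_le n d).trans (Nat.add_le_add_right ih _)

theorem ComparableToPow.add_sum {f : ℕ → ℕ} {d : ℕ} (h : ComparableToPow f d) (q : ℕ) :
    ComparableToPow (fun n => q + ∑ i ∈ Finset.range n, f (i + 1)) (d + 1) := by
  obtain ⟨C, hC⟩ := h
  refine ⟨q + (d + 1) * C + C, fun n hn => ⟨?_, ?_⟩⟩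
  · have h₁ : ∑ i ∈ Finset.range n, (i + 1) ^ d ≤ C * ∑ i ∈ Finset.range n, f (i + 1) := by
      rw [Finset.mul_sum]
      exact Finset.sum_le_sum fun i _ => (hC (i + 1) (by omega)).1
    calc n ^ (d + 1) ≤ (d + 1) * ∑ i ∈ Finset.range n, (i + 1) ^ d := pow_succ_le_mul_sum n d
      _ ≤ (d + 1) * (C * ∑ i ∈ Finset.range n, f (i + 1)) := Nat.mul_le_mul_left _ h₁
      _ = ((d + 1) * C) * ∑ i ∈ Finset.range n, f (i + 1) := by ring
      _ ≤ _ := Nat.mul_le_mul (by omega) (Nat.le_add_left _ _)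
  · have h₂ : ∑ i ∈ Finset.range n, f (i + 1) ≤ C * n ^ (d + 1) := by
      calc ∑ i ∈ Finset.range n, f (i + 1) ≤ ∑ i ∈ Finset.range n, C * n ^ d := by
            refine Finset.sum_le_sum fun i hi => ((hC (i + 1) (by omega)).2).trans ?_
            have := Finset.mem_range.1 hi
            exact Nat.mul_le_mul_left _ (Nat.pow_le_pow_left (by omega) _)
        _ = C * n ^ (d + 1) := by
            rw [Finset.sum_const, Finset.card_range, smul_eq_mul]; ring
    have h₃ : q ≤ q * n ^ (d + 1) := Nat.le_mul_of_pos_right _ (by positivity)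
    calc q + ∑ i ∈ Finset.range n, f (i + 1) ≤ q * n ^ (d + 1) + C * n ^ (d + 1) := by omega
      _ = (q + C) * n ^ (d + 1) := by ring
      _ ≤ _ := Nat.mul_le_mul_right _ (by omega)

theorem ComparableToPow.add {f₁ f₂ : ℕ → ℕ} {d₁ d₂ : ℕ} (h₁ : ComparableToPow f₁ d₁)
    (h₂ : ComparableToPow f₂ d₂) : ComparableToPow (fun n => f₁ n + f₂ n) (max d₁ d₂) := by
  obtain ⟨C₁, h₁⟩ := h₁
  obtain ⟨C₂, h₂⟩ := h₂
  refine ⟨C₁ + C₂, fun n hn => ⟨?_, ?_⟩⟩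
  · rcases max_choice d₁ d₂ with e | e <;> rw [e]
    · exact (h₁ n hn).1.trans (Nat.mul_le_mul (by omega) (Nat.le_add_right _ _))
    · exact (h₂ n hn).1.trans (Nat.mul_le_mul (by omega) (Nat.le_add_left _ _))
  · rw [add_mul]
    exact add_le_add
      ((h₁ n hn).2.trans (Nat.mul_le_mul_left _ (Nat.pow_le_pow_right hn (le_max_left _ _))))
      ((h₂ n hn).2.trans (Nat.mul_le_mul_left _ (Nat.pow_le_pow_right hn (le_max_right _ _))))

mutual

theorem ZigzagTerm.comparableToPow_length {A : Type u} : ∀ t : ZigzagTerm A,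
    ∃ d, t.depth = d + 1 ∧ ComparableToPow (fun n => (t.eval n).length) d
  | .F l => by
    obtain ⟨d, hd, h⟩ := ZigzagList.comparableToPow_length l
    refine ⟨d + 1, by rw [ZigzagTerm.depth, hd], ?_⟩
    simpa only [ZigzagTerm.eval, length_prod_range, zero_add] using h.add_sum 0
  | .B l => by
    obtain ⟨d, hd, h⟩ := ZigzagList.comparableToPow_length l
    refine ⟨d + 1, by rw [ZigzagTerm.depth, hd], ?_⟩
    simpa only [ZigzagTerm.eval, length_prod_reverse_range, zero_add] using h.add_sum 0
  | .S r hr => by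
    refine ⟨0, by rw [ZigzagTerm.depth], r.length, fun n _ => ?_⟩
    have : r.length ≠ 0 := fun h => hr (FreeMonoid.length_eq_zero.1 h)
    simp only [ZigzagTerm.eval, pow_zero, mul_one, le_refl, and_true]
    exact Nat.mul_pos (by omega) (by omega)

theorem ZigzagList.comparableToPow_length {A : Type u} : ∀ l : ZigzagList A,
    ∃ d, l.depth = d + 1 ∧ ComparableToPow (fun n => (l.R n).length) d
  | .single t => by
    obtain ⟨d, hd, h⟩ := ZigzagTerm.comparableToPow_length t
    refine ⟨d, by rw [ZigzagList.depth, hd], ?_⟩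
    simpa only [ZigzagList.R] using h
  | .cons t l => by
    obtain ⟨d, hd, h⟩ := ZigzagTerm.comparableToPow_length t
    obtain ⟨d', hd', h'⟩ := ZigzagList.comparableToPow_length l
    refine ⟨max d d', by rw [ZigzagList.depth, hd, hd', max_add_add_right], ?_⟩
    simpa only [ZigzagList.R, FreeMonoid.length_mul] using h.add h'

end

theorem ComparableToPow.isTheta {f : ℕ → ℕ} {d : ℕ} (h : ComparableToPow f d) :
    (fun n => (f n : ℝ)) =Θ[atTop] fun n : ℕ => (n : ℝ) ^ d := by
  obtain ⟨C, hC⟩ := h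
  constructor
  · refine IsBigO.of_bound C ?_
    filter_upwards [eventually_ge_atTop 1] with n hn
    rw [Real.norm_of_nonneg (by positivity), Real.norm_of_nonneg (by positivity)]
    exact_mod_cast (hC n hn).2
  · refine IsBigO.of_bound C ?_
    filter_upwards [eventually_ge_atTop 1] with n hn
    rw [Real.norm_of_nonneg (by positivity), Real.norm_of_nonneg (by positivity)]
    exact_mod_cast (hC n hn).1

theorem length_partialConcat_isTheta {A : Type u} (q : FreeMonoid A) (l : ZigzagList A) :
    (fun n => ((partialConcat q (fun i => l.R (i + 1)) n).length : ℝ))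
      =Θ[atTop] fun n : ℕ => (n : ℝ) ^ l.depth := by
  obtain ⟨d, hd, h⟩ := l.comparableToPow_length
  rw [hd]
  have := (h.add_sum q.length).isTheta
  simpa only [partialConcat, FreeMonoid.length_mul, length_prod_range] using this

theorem natCast_pow_isTheta_iff {d k : ℕ} :
    ((fun n : ℕ => (n : ℝ) ^ d) =Θ[atTop] fun n : ℕ => (n : ℝ) ^ k) ↔ d = k := by
  have key : ∀ {d k : ℕ}, d < k →
      ¬ ((fun n : ℕ => (n : ℝ) ^ k) =O[atTop] fun n : ℕ => (n : ℝ) ^ d) := fun {d k} hdk h => by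
    have h' : (fun n : ℕ => (n : ℝ) ^ d) =o[atTop] fun n : ℕ => (n : ℝ) ^ k :=
      (isLittleO_pow_pow_atTop_of_lt hdk).comp_tendsto tendsto_natCast_atTop_atTop
    refine h.not_isLittleO (Eventually.frequently ?_) h'
    filter_upwards [eventually_ge_atTop 1] with n hn
    have : n ≠ 0 := by omega
    positivity
  refine ⟨fun h => ?_, fun h => h ▸ isTheta_rfl⟩
  rcases lt_trichotomy d k with hdk | hdk | hdk
  · exact absurd h.2 (key hdk)
  · exact hdk
  · exact absurd h.1 (key hdk)

theorem natCast_affine_pow_isTheta {a : ℕ} (ha : 1 ≤ a) (b k : ℕ) :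
    (fun n : ℕ => ((a * n + b : ℕ) : ℝ) ^ k) =Θ[atTop] fun n : ℕ => (n : ℝ) ^ k := by
  refine IsTheta.pow ?_ k
  have : ComparableToPow (fun n => a * n + b) 1 := by
    refine ⟨a + b, fun n hn => ?_⟩
    simp only [pow_one]
    have h : n ≤ a * n := Nat.le_mul_of_pos_left _ ha
    exact ⟨(h.trans (Nat.le_add_right _ b)).trans (Nat.le_mul_of_pos_left _ (by omega)),
      by nlinarith⟩
  simpa using this.isTheta

/-! ### Letters occurring in images under a morphism -/

theorem FreeMonoid.mem_hom_apply {A : Type u} {B : Type v} (f : FreeMonoid B →* FreeMonoid A)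
    {a : A} {w : FreeMonoid B} : a ∈ f w ↔ ∃ b ∈ w, a ∈ f (.of b) := by
  induction w using FreeMonoid.inductionOn' with
  | one => simp [FreeMonoid.notMem_one]
  | of_mul b w ih => simp [map_mul, FreeMonoid.mem_mul, ih, or_and_right, exists_or]

theorem FreeMonoid.exists_eq_mul_of_mem {B : Type v} {b : B} {w : FreeMonoid B} (h : b ∈ w) :
    ∃ u v : FreeMonoid B, w = u * .of b * v := by
  obtain ⟨s, t, e⟩ := List.append_of_mem (show b ∈ w.toList from h)
  refine ⟨.ofList s, .ofList t, FreeMonoid.toList.injective ?_⟩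
  rw [e]
  simp

theorem FreeMonoid.length_hom_of_le {A : Type u} {B : Type v} (f : FreeMonoid B →* FreeMonoid A)
    {b : B} {w : FreeMonoid B} (h : b ∈ w) : (f (.of b)).length ≤ (f w).length := by
  obtain ⟨u, v, rfl⟩ := FreeMonoid.exists_eq_mul_of_mem h
  simp only [map_mul, FreeMonoid.length_mul]
  omega

theorem IsCoding.length_apply {A : Type u} {B : Type v} {τ : FreeMonoid B →* FreeMonoid A}
    (hτ : IsCoding τ) (w : FreeMonoid B) : (τ w).length = w.length := by
  induction w using FreeMonoid.inductionOn' with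
  | one => simp
  | of_mul b w ih => simp [map_mul, FreeMonoid.length_mul, ih, hτ b]

theorem exists_hom_eq_iterate {B : Type v} (h : FreeMonoid B →* FreeMonoid B) (p : ℕ) :
    ∃ g : FreeMonoid B →* FreeMonoid B, ⇑g = h^[p] :=
  ⟨⟨⟨h^[p], iterate_map_one h p⟩, iterate_map_mul h p⟩, rfl⟩

theorem mem_iterate_trans {B : Type v} (h : FreeMonoid B →* FreeMonoid B) {a b c : B} {m n : ℕ}
    (hab : b ∈ h^[m] (.of a)) (hbc : c ∈ h^[n] (.of b)) : c ∈ h^[n + m] (.of a) := by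
  obtain ⟨g, hg⟩ := exists_hom_eq_iterate h n
  rw [Function.iterate_add_apply, ← hg, FreeMonoid.mem_hom_apply]
  exact ⟨b, hab, by rwa [hg]⟩

theorem mem_iterate_mul {B : Type v} (h : FreeMonoid B →* FreeMonoid B) {b : B} {n : ℕ}
    (hb : b ∈ h^[n] (.of b)) (j : ℕ) : b ∈ h^[n * j] (.of b) := by
  induction j with
  | zero => exact FreeMonoid.mem_of_self
  | succ j ih =>
    rw [mul_add, mul_one, add_comm]
    exact mem_iterate_trans h ih hb

theorem exists_uniform_return_time {B : Type v} [Finite B] (h : FreeMonoid B →* FreeMonoid B) :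
    ∃ p, 1 ≤ p ∧ ∀ b n, 1 ≤ n → b ∈ h^[n] (.of b) → b ∈ h^[p] (.of b) := by
  have := Fintype.ofFinite B
  have hr : ∀ b, ∃ r, 1 ≤ r ∧ ∀ n, 1 ≤ n → b ∈ h^[n] (.of b) → b ∈ h^[r] (.of b) := fun b => by
    by_cases hb : ∃ n, 1 ≤ n ∧ b ∈ h^[n] (.of b)
    · obtain ⟨n, hn, hb⟩ := hb
      exact ⟨n, hn, fun _ _ _ => hb⟩
    · exact ⟨1, le_rfl, fun n hn hn' => absurd ⟨n, hn, hn'⟩ hb⟩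
  choose r hr₁ hr₂ using hr
  refine ⟨∏ b, r b,
    Nat.one_le_iff_ne_zero.2 (Finset.prod_ne_zero_iff.2 fun b _ => by have := hr₁ b; omega),
    fun b n hn hb => ?_⟩
  obtain ⟨j, hj⟩ := Finset.dvd_prod_of_mem r (Finset.mem_univ b)
  rw [hj]
  exact mem_iterate_mul h (hr₂ b n hn hb) j

/-! ### Zigzag structure of iterated images of letters -/

theorem EventuallyZigzag.hom_iterate {A : Type u} {B : Type v} {g : FreeMonoid B →* FreeMonoid B}
    {τ : FreeMonoid B →* FreeMonoid A} {w : FreeMonoid B}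
    (H : ∀ b ∈ w, EventuallyZigzag fun n => τ (g^[n] (.of b))) :
    EventuallyZigzag fun n => τ (g^[n] w) := by
  induction w using FreeMonoid.inductionOn' with
  | one => simpa only [iterate_map_one, map_one] using EventuallyZigzag.const (1 : FreeMonoid A)
  | of_mul b w ih =>
    simp only [iterate_map_mul, map_mul]
    exact (H b (FreeMonoid.mem_mul.2 (.inl FreeMonoid.mem_of_self))).mul
      (ih fun a ha => H a (FreeMonoid.mem_mul.2 (.inr ha)))

theorem eventuallyZigzag_iterate_of {A : Type u} {B : Type v} [Finite B]
    (g : FreeMonoid B →* FreeMonoid B) (τ : FreeMonoid B →* FreeMonoid A) (S : Set B)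
    (hS : ∀ b ∈ S, ∀ a ∈ g (.of b), a ∈ S)
    (hone : ∀ b ∈ S, ∀ n u v, g^[n] (.of b) = u * .of b * v → b ∉ u ∧ b ∉ v)
    (hret : ∀ b n, 1 ≤ n → b ∈ g^[n] (.of b) → b ∈ g (.of b)) :
    ∀ b ∈ S, EventuallyZigzag fun n => τ (g^[n] (.of b)) := by
  suffices ∀ N, ∀ b ∈ S, {x | ∃ m, x ∈ g^[m] (.of b)}.ncard = N →
      EventuallyZigzag fun n => τ (g^[n] (.of b)) from fun b hb => this _ b hb rfl
  intro N
  induction N using Nat.strong_induction_on with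
  | _ N ih =>
    rintro b hb rfl
    have lower : ∀ a ∈ g (.of b), (∀ m, b ∉ g^[m] (.of a)) →
        EventuallyZigzag fun n => τ (g^[n] (.of a)) := fun a ha hba => by
      refine ih _ (Set.ncard_lt_ncard ⟨?_, ?_⟩ (Set.toFinite _)) a (hS b hb a ha) rfl
      · rintro x ⟨m, hm⟩
        exact ⟨m + 1, mem_iterate_trans g (m := 1) ha hm⟩
      · intro hsub
        obtain ⟨m, hm⟩ := hsub ⟨0, FreeMonoid.mem_of_self⟩
        exact hba m hm
    by_cases hbg : b ∈ g (.of b)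
    · obtain ⟨u, v, e⟩ := FreeMonoid.exists_eq_mul_of_mem hbg
      have key : ∀ m, b ∉ g^[m] u ∧ b ∉ g^[m] v := fun m => by
        obtain ⟨u', v', e'⟩ := FreeMonoid.exists_eq_mul_of_mem
          (show b ∈ g^[m] (.of b) by simpa using mem_iterate_mul g (n := 1) hbg m)
        have := hone b hb (m + 1) (g^[m] u * u') (v' * g^[m] v) (by
          rw [Function.iterate_succ_apply, e, iterate_map_mul, iterate_map_mul, e']
          simp only [mul_assoc])
        simp only [FreeMonoid.mem_mul, not_or] at this
        exact ⟨this.1.1, this.2.2⟩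
      have mem_of : ∀ {a m w}, a ∈ w → b ∈ g^[m] (.of a) → b ∈ g^[m] w := fun {a m w} ha hm => by
        obtain ⟨f, hf⟩ := exists_hom_eq_iterate g m
        rw [← hf] at hm ⊢
        exact (FreeMonoid.mem_hom_apply f).2 ⟨a, ha, hm⟩
      have hu : EventuallyZigzag fun n => τ (g^[n] u) := .hom_iterate fun a ha =>
        lower a (by rw [e]; simp [FreeMonoid.mem_mul, ha]) fun m hm => (key m).1 (mem_of ha hm)
      have hv : EventuallyZigzag fun n => τ (g^[n] v) := .hom_iterate fun a ha =>
        lower a (by rw [e]; simp [FreeMonoid.mem_mul, ha]) fun m hm => (key m).2 (mem_of ha hm)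
      exact hu.of_recurrence hv fun n => by
        rw [Function.iterate_succ_apply, e, iterate_map_mul, iterate_map_mul, map_mul, map_mul]
    · refine EventuallyZigzag.of_succ ?_
      simp only [Function.iterate_succ_apply]
      exact .hom_iterate fun a ha => lower a ha fun m hm =>
        hbg (hret b (m + 1) (by omega) (mem_iterate_trans g (m := 1) ha hm))

/-! ### Growth of prolongable morphisms -/

section Prolongable

variable {B : Type v} {h : FreeMonoid B →* FreeMonoid B} {c : B} {x : FreeMonoid B}

theorem iterate_succ_of_prolongable (hx : h (.of c) = .of c * x) (n : ℕ) :
    h^[n + 1] (.of c) = h^[n] (.of c) * h^[n] x := by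
  rw [Function.iterate_succ_apply, hx, iterate_map_mul]

theorem partialConcat_iterate_of_prolongable (hx : h (.of c) = .of c * x) (n : ℕ) :
    partialConcat (.of c) (fun i => h^[i] x) n = h^[n] (.of c) := by
  induction n with
  | zero => exact partialConcat_zero _ _
  | succ n ih => rw [partialConcat_succ, ih, iterate_succ_of_prolongable hx]

theorem monotone_length_iterate_of_prolongable (hx : h (.of c) = .of c * x) :
    Monotone fun n => (h^[n] (.of c)).length :=
  monotone_nat_of_le_succ fun n => by
    rw [iterate_succ_of_prolongable hx, FreeMonoid.length_mul]
    exact Nat.le_add_right _ _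

theorem le_length_iterate_of_prolongable (hx : h (.of c) = .of c * x) (hm : ¬ IsMortal h x)
    (n : ℕ) : n ≤ (h^[n] (.of c)).length := by
  induction n with
  | zero => exact Nat.zero_le _
  | succ n ih =>
    have : (h^[n] x).length ≠ 0 := fun e => hm ⟨n, FreeMonoid.length_eq_zero.1 e⟩
    rw [iterate_succ_of_prolongable hx, FreeMonoid.length_mul]
    omega

theorem exists_prolongable_iterate (hx : h (.of c) = .of c * x) {p : ℕ}
    {g : FreeMonoid B →* FreeMonoid B} (hg : ⇑g = h^[p]) : ∃ y, g (.of c) = .of c * y ∧ ∀ a ∈ y, ∃ m, a ∈ h^[m] (.of c) := by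
  have : ∃ y, g (.of c) = .of c * y :=
    ⟨((List.range p).map fun i => h^[i] x).prod, by
      rw [hg, ← partialConcat_iterate_of_prolongable hx, partialConcat]⟩
  obtain ⟨y, hy⟩ := this
  exact ⟨y, hy, fun a ha => ⟨p, by rw [← hg, hy]; exact FreeMonoid.mem_mul.2 (.inr ha)⟩⟩

theorem two_pow_le_length_iterate {b : B} {n : ℕ} {u v : FreeMonoid B}
    (e : h^[n] (.of b) = u * .of b * v) (hb : b ∈ u ∨ b ∈ v) (j : ℕ) :
    2 ^ j ≤ (h^[n * j] (.of b)).length := by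
  induction j with
  | zero => exact le_rfl
  | succ j ih =>
    obtain ⟨f, hf⟩ := exists_hom_eq_iterate h (n * j)
    rw [mul_add, mul_one, Function.iterate_add_apply, e, ← hf]
    rw [← hf] at ih
    simp only [map_mul, FreeMonoid.length_mul]
    rcases hb with hb | hb
    · have := FreeMonoid.length_hom_of_le f hb
      omega
    · have := FreeMonoid.length_hom_of_le f hb
      omega

theorem notMem_of_polynomial_growth (hx : h (.of c) = .of c * x) {k : ℕ}
    (hk : (fun n : ℕ => ((h^[n] (.of c)).length : ℝ)) =O[atTop] fun n : ℕ => (n : ℝ) ^ k)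
    {b : B} {m : ℕ} (hb : b ∈ h^[m] (.of c)) {n : ℕ} {u v : FreeMonoid B}
    (e : h^[n] (.of b) = u * .of b * v) : b ∉ u ∧ b ∉ v := by
  rw [← not_or]
  intro hbuv
  have hle : ∀ j, 2 ^ j ≤ (h^[(n + 1) * j + m] (.of c)).length := fun j => by
    obtain ⟨f, hf⟩ := exists_hom_eq_iterate h (n * j)
    have h₁ := FreeMonoid.length_hom_of_le f hb
    rw [hf, ← Function.iterate_add_apply] at h₁
    exact (two_pow_le_length_iterate e hbuv j).trans
      (h₁.trans (monotone_length_iterate_of_prolongable hx (by nlinarith)))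
  have htend : Tendsto (fun j => (n + 1) * j + m) atTop atTop :=
    tendsto_atTop_mono (fun j => show j ≤ _ by nlinarith) tendsto_id
  have hO : (fun j : ℕ => (2 : ℝ) ^ j) =O[atTop] fun j : ℕ => (j : ℝ) ^ k := by
    refine (IsBigO.of_bound' ?_).trans ((hk.comp_tendsto htend).trans
      (natCast_affine_pow_isTheta (Nat.le_add_left 1 n) m k).1)
    refine Eventually.of_forall fun j => ?_
    rw [Real.norm_of_nonneg (by positivity), Function.comp_apply,
      Real.norm_of_nonneg (by positivity)]
    exact_mod_cast hle j
  exact hO.not_isLittleO (Eventually.frequently (Eventually.of_forall fun j => by positivity))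
    (isLittleO_pow_const_const_pow_of_one_lt k one_lt_two)

end Prolongable

theorem IsImageOf.isPrefixOf {A : Type u} {B : Type v} {τ : FreeMonoid B →* FreeMonoid A}
    {β : ℕ → B} {α : ℕ → A} (hα : IsImageOf τ β α) {w : FreeMonoid B} (hw : IsPrefixOf w β) :
    IsPrefixOf (τ w) α := by
  have e : τ w = partialConcat 1 (fun i => τ (.of (β i))) w.length := by
    have hw' : w = .ofList ((List.range w.length).map β) := FreeMonoid.toList.injective hw
    conv_lhs => rw [hw', ← FreeMonoid.lift_restrict τ, FreeMonoid.lift_ofList]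
    simp [partialConcat, Function.comp_def]
  rw [e]
  exact hα.1 _

theorem theorem2 {A : Type u} [Finite A] (α : ℕ → A) (k : ℕ)
    (hα : IsMorphicWithGrowth.{u, v} α k) : IsZigzagOfDepth α k := by
  obtain ⟨B, _, h, τ, c, β, hτ, ⟨x, hx, hmortal, hβ⟩, himage, hgrowth⟩ := hα
  obtain ⟨p, hp, hret⟩ := exists_uniform_return_time h
  obtain ⟨g, hg⟩ := exists_hom_eq_iterate h p
  have hiter : ∀ n, g^[n] = h^[p * n] := fun n => by rw [hg, Function.iterate_mul]
  obtain ⟨y, hy, hyS⟩ := exists_prolongable_iterate hx hg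
  have hzigzag := EventuallyZigzag.hom_iterate (w := y) fun b hb =>
    eventuallyZigzag_iterate_of g τ {b | ∃ m, b ∈ h^[m] (.of c)}
      (fun b ⟨m, hm⟩ a ha => ⟨p + m, mem_iterate_trans h hm (by rwa [hg] at ha)⟩)
      (fun b ⟨m, hm⟩ n u v e => notMem_of_polynomial_growth hx hgrowth.1 hm (by rwa [hiter] at e))
      (fun b n hn hb => by
        rw [hiter] at hb
        rw [hg]
        exact hret b (p * n) (Nat.mul_pos hp hn) hb)
      b (hyS b hb)
  obtain ⟨M, hM⟩ := hzigzag
  obtain ⟨ts, hts⟩ := hM M le_rfl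
  have hconcat : ∀ n, partialConcat (τ (g^[M + 1] (.of c))) (fun i => evalTerms ts (i + 1)) n =
      τ (h^[p * n + p * (M + 1)] (.of c)) := fun n => by
    rw [← mul_add, ← hiter]
    induction n with
    | zero => rw [partialConcat_zero, zero_add]
    | succ n ih =>
      rw [partialConcat_succ, ih, hts, ← map_mul, add_right_comm n 1 (M + 1),
        iterate_succ_of_prolongable hy, add_right_comm n 1 M, add_assoc n M 1]
  have hlength : ∀ n, n ≤
      (partialConcat (τ (g^[M + 1] (.of c))) (fun i => evalTerms ts (i + 1)) n).length := fun n => by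
    rw [hconcat, hτ.length_apply]
    exact le_trans (by nlinarith) (le_length_iterate_of_prolongable hx hmortal _)
  have hne : ts ≠ [] := by
    rintro rfl
    have := hlength ((τ (g^[M + 1] (.of c))).length + 1)
    simp [partialConcat, evalTerms_nil] at this
  obtain ⟨l, hl⟩ := exists_zigzagList_of_ne_nil ts hne
  simp only [← hl] at hconcat hlength
  refine ⟨τ (g^[M + 1] (.of c)), l, ?_, fun n => ?_, fun N => ⟨N, hlength N⟩⟩
  · refine natCast_pow_isTheta_iff.1 ((length_partialConcat_isTheta (τ (g^[M + 1] (.of c))) l).symm.trans ?_)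
    simp only [hconcat, hτ.length_apply]
    have htend : Tendsto (fun n => p * n + p * (M + 1)) atTop atTop :=
      tendsto_atTop_mono (fun n => show n ≤ _ by nlinarith) tendsto_id
    exact IsTheta.trans ⟨hgrowth.1.comp_tendsto htend, hgrowth.2.comp_tendsto htend⟩
      (natCast_affine_pow_isTheta hp (p * (M + 1)) k)
  · rw [hconcat]
    refine himage.isPrefixOf ?_
    rw [← partialConcat_iterate_of_prolongable hx]
    exact hβ.1 _
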